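/- A hypergraph $H=(V,E)$ consists of a finite set $V$ of vertices and a set $E$ of subsets of $V$, called edges (no multiple edges); write $n_H=|V|$. For an integer $k\ge 3$, let $\mathcal{H}_k^*$ be the class of all hypergraphs $H$ such that every edge of $H$ has exactly $k$ vertices, every vertex of $H$ lies in at least one edge, every edge of $H$ intersects at least one other edge, and no two distinct edges of $H$ intersect in exactly $k-1$ vertices. A total dominating set of $H$ is a set $D\subseteq V$ such that for every vertex $v\in V$ there is an edge $e\in E$ with $v\in e$ and $e\cap(D\setminus\{v\})\neq\emptyset$; the total domination number $\gamma_t(H)$ is the minimum cardinality of a total dominating set of $H$. **Corollary 5.** For every integer $k\ge 4$ and every $H\in\mathcal{H}_k^*$, \[ \gamma_t(H)\le \frac{n_H}{3}. \] -/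

import Mathlib

namespace Hypergraph

/-- A hypergraph is `k`-uniform if every edge has exactly `k` vertices. -/
def IsUniform {α : Type*} (H : Hypergraph α) (k : ℕ) : Prop :=
  ∀ e ∈ H.edgeSet, e.encard = k

/-- An isolated edge is an edge that does not intersect any other edge. -/
def IsIsolatedEdge {α : Type*} (H : Hypergraph α) (e : Set α) : Prop :=
  e ∈ H.edgeSet ∧ ∀ f ∈ H.edgeSet, f ≠ e → Disjoint e f

/-- The class `𝓗ₖ`: finite `k`-uniform hypergraphs with no isolated vertex and no isolated edge.
There are no multiple edges, since `edgeSet` is a set. -/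
structure MemClassH {α : Type*} (H : Hypergraph α) (k : ℕ) : Prop where
  finite : H.vertexSet.Finite
  uniform : H.IsUniform k
  no_isolated_vertex : ∀ v ∈ H.vertexSet, ¬ H.IsIsolated v
  no_isolated_edge : ∀ e, ¬ H.IsIsolatedEdge e

/-- The class `𝓗ₖ*`: the members of `𝓗ₖ` in which no two (distinct) edges intersect in exactly
`k - 1` vertices. -/
structure MemClassHStar {α : Type*} (H : Hypergraph α) (k : ℕ) : Prop extends
    H.MemClassH k where
  inter_ne : ∀ e ∈ H.edgeSet, ∀ f ∈ H.edgeSet, e ≠ f → (e ∩ f).encard + 1 ≠ k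

/-- `D` is a total dominating set: a set of vertices such that every vertex `v` (in `D` or not)
lies in an edge that contains an element of `D` other than `v`. -/
def IsTotalDominatingSet {α : Type*} (H : Hypergraph α) (D : Set α) : Prop :=
  D ⊆ H.vertexSet ∧
    ∀ v ∈ H.vertexSet, ∃ e ∈ H.edgeSet, v ∈ e ∧ (e ∩ (D \ {v})).Nonempty

/-- The total domination number `γₜ(H)`: the minimum cardinality of a total dominating set. -/
noncomputable def totalDominationNumber {α : Type*} (H : Hypergraph α) : ℕ :=
  sInf {n : ℕ | ∃ D : Set α, H.IsTotalDominatingSet D ∧ D.encard = n}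

/-- On the classes considered here a total dominating set exists, so `totalDominationNumber` is
a true minimum. -/
theorem MemClassH.isLeast_totalDominationNumber {α : Type*} {H : Hypergraph α} {k : ℕ}
    (hH : H.MemClassH k) (hk : 2 ≤ k) :
    IsLeast {n : ℕ | ∃ D : Set α, H.IsTotalDominatingSet D ∧ D.encard = n}
      H.totalDominationNumber := by
  refine ⟨Nat.sInf_mem ⟨H.vertexSet.ncard, H.vertexSet, ⟨subset_rfl, fun v hv => ?_⟩,
    hH.finite.cast_ncard_eq.symm⟩, fun n hn => Nat.sInf_le hn⟩
  have h := hH.no_isolated_vertex v hv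
  simp only [IsIsolated, not_forall, not_not] at h
  obtain ⟨e, he, hve⟩ := h
  have h1 : 1 < e.encard := by
    rw [hH.uniform e he]
    exact_mod_cast hk
  obtain ⟨w, hw, hne⟩ := Set.exists_ne_of_one_lt_encard h1 v
  exact ⟨e, he, hve, w, hw, H.subset_vertexSet_of_mem_edgeSet' he hw, hne⟩

end Hypergraph

/-! Pass to a minimal subfamily `C` of the edges that still covers all vertices and has no isolated
edge; dominating through `C` suffices. By minimality each `e ∈ C` has a private vertex, or removing
it would isolate a leaf edge attached to it. This yields distinct tokens, one per edge of `C`, each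
lying in only one edge (`exists_tokens`).

Delete the tokens from all edges. A total transversal `T` of the reduced edges hits every edge and
gives each of its own vertices a neighbour in `T`, so it is totally dominating. The tokens number
`|C|` and are disjoint from the reduced edges, so it is enough that `3|T|` is at most the number of
reduced vertices plus the number of edges, the `weight`.

This bound (`bounded`) is proved greedily: choose one or two vertices, discard the edges they hit,
and check that the weight falls by at least 3 per chosen vertex. Vertices left without an edge count
towards the fall. The tight case, linear of maximum degree two, needs an induction that carries one
extra unit when a degree-one vertex exists. -/

/-! ### Relative total transversals and the greedy step -/

namespace TotalTransversal

variable {ι α : Type*} [DecidableEq α]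

/-- The edges indexed by `X` that are disjoint from `S`. -/
def unhit (A : ι → Finset α) (X : Finset ι) (S : Finset α) : Finset ι :=
  X.filter fun i => ∀ v ∈ S, v ∉ A i

/-- The number of vertices covered by the edges indexed by `X`, plus the number of these edges. -/
def weight (A : ι → Finset α) (X : Finset ι) : ℕ := (X.biUnion A).card + X.card

/-- `v` has a neighbour in `S` through an edge of `X`, or lies in an edge of `E` outside `X`. -/
def Supported (A : ι → Finset α) (E X : Finset ι) (S : Finset α) (v : α) : Prop :=
  (∃ i ∈ X, ∃ w ∈ S, w ≠ v ∧ v ∈ A i ∧ w ∈ A i) ∨ ∃ i ∈ E, i ∉ X ∧ v ∈ A i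

/-- `T` is a transversal of the edges in `X`, total up to vertices in edges of `E` outside `X`. -/
structure IsRelTotal (A : ι → Finset α) (E X : Finset ι) (T : Finset α) : Prop where
  subset : T ⊆ X.biUnion A
  hits : ∀ i ∈ X, ∃ v ∈ T, v ∈ A i
  supported : ∀ v ∈ T, Supported A E X T v

/-- There is a relative total transversal `T` of `X` with `3 |T| + c ≤ weight X`. -/
def Bounded (A : ι → Finset α) (E X : Finset ι) (c : ℕ) : Prop :=
  ∃ T, IsRelTotal A E X T ∧ 3 * T.card + c ≤ weight A X

variable {A : ι → Finset α} {E X : Finset ι}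

lemma unhit_subset (A : ι → Finset α) (X : Finset ι) (S : Finset α) : unhit A X S ⊆ X :=
  Finset.filter_subset _ _

lemma mem_unhit {S : Finset α} {i : ι} : i ∈ unhit A X S ↔ i ∈ X ∧ ∀ v ∈ S, v ∉ A i := by
  simp [unhit]

lemma unhit_ssubset {S : Finset α} {v : α} {i : ι} (hi : i ∈ X) (hv : v ∈ S) (hvi : v ∈ A i) :
    unhit A X S ⊂ X :=
  (Finset.ssubset_iff_of_subset (unhit_subset A X S)).2
    ⟨i, hi, fun h => (mem_unhit.1 h).2 v hv hvi⟩

lemma bounded_empty : Bounded A E ∅ 0 :=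
  ⟨∅, ⟨by simp, by simp, by simp⟩, by simp [weight]⟩

/-- An edge that supports `v ∈ T` from outside `unhit A X S` is either outside `X` or hit by some `w
∈ S`. In the latter case `w ≠ v`, since `v` also lies in an edge that `S` misses. -/
lemma IsRelTotal.union {S T : Finset α} (hS : S ⊆ X.biUnion A)
    (hsup : ∀ v ∈ S, Supported A E X S v) (hT : IsRelTotal A E (unhit A X S) T) :
    IsRelTotal A E X (S ∪ T) := by
  refine ⟨Finset.union_subset hS (hT.subset.trans
    (Finset.biUnion_subset_biUnion_of_subset_left _ (unhit_subset A X S))), fun i hi => ?_,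
    fun v hv => ?_⟩
  · by_cases h : i ∈ unhit A X S
    · obtain ⟨v, hv, hvi⟩ := hT.hits i h
      exact ⟨v, Finset.mem_union_right _ hv, hvi⟩
    · rw [mem_unhit] at h
      push Not at h
      obtain ⟨v, hv, hvi⟩ := h hi
      exact ⟨v, Finset.mem_union_left _ hv, hvi⟩
  · rcases Finset.mem_union.1 hv with hv | hv
    · rcases hsup v hv with ⟨i, hi, w, hw, h⟩ | h
      · exact Or.inl ⟨i, hi, w, Finset.mem_union_left _ hw, h⟩
      · exact Or.inr h
    · rcases hT.supported v hv with ⟨i, hi, w, hw, h⟩ | ⟨i, hi, hiX, hvi⟩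
      · exact Or.inl ⟨i, unhit_subset A X S hi, w, Finset.mem_union_right _ hw, h⟩
      · by_cases hX : i ∈ X
        · rw [mem_unhit] at hiX
          push Not at hiX
          obtain ⟨w, hw, hwi⟩ := hiX hX
          refine Or.inl ⟨i, hX, w, Finset.mem_union_left _ hw, ?_, hvi, hwi⟩
          rintro rfl
          obtain ⟨j, hj, hwj⟩ := Finset.mem_biUnion.1 (hT.subset hv)
          exact (mem_unhit.1 hj).2 w hw hwj
        · exact Or.inr ⟨i, hi, hX, hvi⟩

/-- `Z` collects vertices that die, all their edges in `X` being hit by `S`; `R` collects edges that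
are hit. -/
lemma weight_unhit_add_le {S Z : Finset α} {R : Finset ι} (hZ : Z ⊆ X.biUnion A)
    (hZS : ∀ z ∈ Z, ∀ i ∈ X, z ∈ A i → ∃ v ∈ S, v ∈ A i) (hR : R ⊆ X)
    (hRS : ∀ i ∈ R, ∃ v ∈ S, v ∈ A i) :
    weight A (unhit A X S) + Z.card + R.card ≤ weight A X := by
  have h1 : ((unhit A X S).biUnion A).card + Z.card ≤ (X.biUnion A).card := by
    rw [← Finset.card_union_of_disjoint]
    · exact Finset.card_le_card (Finset.union_subset
        (Finset.biUnion_subset_biUnion_of_subset_left _ (unhit_subset A X S)) hZ)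
    · refine Finset.disjoint_left.2 fun z hz hzZ => ?_
      obtain ⟨i, hi, hzi⟩ := Finset.mem_biUnion.1 hz
      obtain ⟨v, hv, hvi⟩ := hZS z hzZ i (unhit_subset A X S hi) hzi
      exact (mem_unhit.1 hi).2 v hv hvi
  have h2 : (unhit A X S).card + R.card ≤ X.card := by
    classical
    rw [← Finset.card_union_of_disjoint]
    · exact Finset.card_le_card (Finset.union_subset (unhit_subset A X S) hR)
    · refine Finset.disjoint_left.2 fun i hi hiR => ?_
      obtain ⟨v, hv, hvi⟩ := hRS i hiR
      exact (mem_unhit.1 hi).2 v hv hvi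
  unfold weight
  omega

lemma Bounded.step {S Z : Finset α} {R : Finset ι} {c d : ℕ}
    (hsup : ∀ v ∈ S, Supported A E X S v) (hS : S ⊆ X.biUnion A) (hZ : Z ⊆ X.biUnion A)
    (hZS : ∀ z ∈ Z, ∀ i ∈ X, z ∈ A i → ∃ v ∈ S, v ∈ A i) (hR : R ⊆ X)
    (hRS : ∀ i ∈ R, ∃ v ∈ S, v ∈ A i) (hb : Bounded A E (unhit A X S) d)
    (hc : 3 * S.card + c ≤ Z.card + R.card + d) : Bounded A E X c := by
  obtain ⟨T, hT, hTc⟩ := hb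
  refine ⟨S ∪ T, hT.union hS hsup, ?_⟩
  have := weight_unhit_add_le hZ hZS hR hRS
  have := Finset.card_union_le S T
  omega

/-- Adding a single vertex `x` that lies in an edge outside `X`. -/
lemma Bounded.step_one {Z : Finset α} {R : Finset ι} {c d : ℕ} {x : α}
    (hx : ∃ i ∈ E, i ∉ X ∧ x ∈ A i) (hxX : ∃ i ∈ X, x ∈ A i)
    (hZ : ∀ z ∈ Z, ∃ i ∈ X, z ∈ A i) (hZS : ∀ z ∈ Z, ∀ i ∈ X, z ∈ A i → x ∈ A i)
    (hR : ∀ i ∈ R, i ∈ X ∧ x ∈ A i) (hb : Bounded A E (unhit A X {x}) d)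
    (hc : 3 + c ≤ Z.card + R.card + d) : Bounded A E X c := by
  refine Bounded.step (S := {x}) (Z := Z) (R := R) ?_ ?_ ?_ ?_ ?_ ?_ hb (by simpa using hc)
  · simp only [Finset.mem_singleton, forall_eq]
    exact Or.inr hx
  · simpa using hxX
  · intro z hz
    simpa using hZ z hz
  · simpa using hZS
  · exact fun i hi => (hR i hi).1
  · simpa using fun i hi => (hR i hi).2

/-- Adding two vertices of a common edge of `X`. -/
lemma Bounded.step_two {Z : Finset α} {R : Finset ι} {c d : ℕ} {x y : α} {e : ι}
    (he : e ∈ X) (hx : x ∈ A e) (hy : y ∈ A e) (hxy : x ≠ y)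
    (hZ : ∀ z ∈ Z, ∃ i ∈ X, z ∈ A i) (hZS : ∀ z ∈ Z, ∀ i ∈ X, z ∈ A i → x ∈ A i ∨ y ∈ A i)
    (hR : ∀ i ∈ R, i ∈ X ∧ (x ∈ A i ∨ y ∈ A i)) (hb : Bounded A E (unhit A X {x, y}) d)
    (hc : 6 + c ≤ Z.card + R.card + d) : Bounded A E X c := by
  refine Bounded.step (S := {x, y}) (Z := Z) (R := R) ?_ ?_ ?_ ?_ ?_ ?_ hb
    (by rw [Finset.card_pair hxy]; exact hc)
  · intro v hv
    left
    simp only [Finset.mem_insert, Finset.mem_singleton] at hv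
    rcases hv with rfl | rfl
    · exact ⟨e, he, y, by simp, hxy.symm, hx, hy⟩
    · exact ⟨e, he, x, by simp, hxy, hy, hx⟩
  · intro v hv
    simp only [Finset.mem_insert, Finset.mem_singleton] at hv
    rcases hv with rfl | rfl <;> exact Finset.mem_biUnion.2 ⟨e, he, ‹_›⟩
  · intro z hz
    simpa using hZ z hz
  · simpa using hZS
  · exact fun i hi => (hR i hi).1
  · simpa using fun i hi => (hR i hi).2

end TotalTransversal

/-! ### Linear families of maximum degree two -/

namespace TotalTransversal

variable {ι α : Type*} [DecidableEq α] {A : ι → Finset α} {E X : Finset ι}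

/-- Some vertex lies in exactly one edge of `X`. -/
def Pendant (A : ι → Finset α) (X : Finset ι) : Prop :=
  ∃ w, ∃ i ∈ X, w ∈ A i ∧ ∀ j ∈ X, w ∈ A j → j = i

/-- Every vertex lies in at most two edges of `X`. -/
def MaxDegreeTwo (A : ι → Finset α) (X : Finset ι) : Prop :=
  ∀ v, ∀ i ∈ X, ∀ j ∈ X, ∀ l ∈ X, v ∈ A i → v ∈ A j → v ∈ A l → i = j ∨ i = l ∨ j = l

/-- Distinct edges of `X` share at most one vertex. -/
def Linear (A : ι → Finset α) (X : Finset ι) : Prop :=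
  ∀ i ∈ X, ∀ j ∈ X, ∀ u v, u ∈ A i → u ∈ A j → v ∈ A i → v ∈ A j → u = v ∨ i = j

lemma Linear.five_le_card_union (hlin : Linear A X) (h3 : ∀ i ∈ X, 3 ≤ (A i).card) {e f : ι}
    (he : e ∈ X) (hf : f ∈ X) (hef : e ≠ f) : 5 ≤ (A e ∪ A f).card := by
  have h1 : (A e ∩ A f).card ≤ 1 := by
    rw [Finset.card_le_one]
    intro a ha b hb
    rw [Finset.mem_inter] at ha hb
    exact (hlin e he f hf a b ha.1 ha.2 hb.1 hb.2).resolve_right hef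
  have := Finset.card_union_add_card_inter (A e) (A f)
  have := h3 e he
  have := h3 f hf
  omega

variable [DecidableEq ι]

/-- Choosing `u` and `x` removes three edges and two vertices, one short of the required 6. The
missing unit comes from a pendant vertex of the remainder, or else from all of `A e ∪ A f` dying. A
vertex pendant in `X` on one of the three edges dies too and gives the extra unit. -/
lemma bounded_of_path (h3 : ∀ i ∈ X, 3 ≤ (A i).card)
    (hdeg : MaxDegreeTwo A X) (hlin : Linear A X) {e f g : ι} {u x : α}
    (he : e ∈ X) (hf : f ∈ X) (hg : g ∈ X) (hef : e ≠ f) (heg : e ≠ g) (hfg : f ≠ g)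
    (hue : u ∈ A e) (huf : u ∈ A f) (hxe : x ∈ A e) (hxg : x ∈ A g)
    (ih : Bounded A E (unhit A X {u, x}) 0 ∧
      (Pendant A (unhit A X {u, x}) → Bounded A E (unhit A X {u, x}) 1)) :
    Bounded A E X 0 ∧
      ∀ w, ∀ i ∈ X, w ∈ A i → (∀ j ∈ X, w ∈ A j → j = i) → (i = e ∨ i = f ∨ i = g) →
        Bounded A E X 1 := by
  have hux : u ≠ x := by
    rintro rfl
    rcases hdeg u e he f hf g hg hue huf hxg with h | h | h <;> contradiction
  have hR : ∀ i ∈ ({e, f, g} : Finset ι), i ∈ X ∧ (u ∈ A i ∨ x ∈ A i) := by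
    simp only [Finset.mem_insert, Finset.mem_singleton]
    rintro i (rfl | rfl | rfl) <;> simp [*]
  have hRc : ({e, f, g} : Finset ι).card = 3 := Finset.card_eq_three.2 ⟨e, f, g, hef, heg, hfg, rfl⟩
  by_cases hp : Pendant A (unhit A X {u, x})
  · refine ⟨?_, fun w i hi hwi hw hefg => ?_⟩
    · refine Bounded.step_two (Z := {u, x}) (R := {e, f, g}) he hue hxe hux ?_ ?_ hR (ih.2 hp) ?_
      · simp only [Finset.mem_insert, Finset.mem_singleton]
        rintro z (rfl | rfl) <;> exact ⟨e, he, ‹_›⟩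
      · simp only [Finset.mem_insert, Finset.mem_singleton]
        rintro z (rfl | rfl) j hj hz <;> simp [hz]
      · rw [hRc, Finset.card_pair hux]
    · refine Bounded.step_two (Z := {u, x, w}) (R := {e, f, g}) he hue hxe hux ?_ ?_ hR
        (ih.2 hp) ?_
      · simp only [Finset.mem_insert, Finset.mem_singleton]
        rintro z (rfl | rfl | rfl)
        exacts [⟨e, he, hue⟩, ⟨e, he, hxe⟩, ⟨i, hi, hwi⟩]
      · simp only [Finset.mem_insert, Finset.mem_singleton]
        rintro z (rfl | rfl | rfl) j hj hz
        · simp [hz]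
        · simp [hz]
        · obtain rfl := hw j hj hz
          exact (hR j (by simpa using hefg)).2
      · have huw : u ≠ w := by
          rintro rfl
          exact hef ((hw e he hue).trans (hw f hf huf).symm)
        have hxw : x ≠ w := by
          rintro rfl
          exact heg ((hw e he hxe).trans (hw g hg hxg).symm)
        rw [hRc, Finset.card_eq_three.2 ⟨u, x, w, hux, huw, hxw, rfl⟩]
  · have key : Bounded A E X 1 := by
      refine Bounded.step_two (Z := A e ∪ A f) (R := {e, f, g}) he hue hxe hux ?_ ?_ hR ih.1 ?_
      · intro z hz
        rcases Finset.mem_union.1 hz with hz | hz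
        exacts [⟨e, he, hz⟩, ⟨f, hf, hz⟩]
      -- A surviving `z` has already lost an edge through `u`, so by the degree bound it would be
      -- pendant in the remainder.
      · intro z hz j hj hzj
        by_contra! hcon
        have hju : j ∈ unhit A X {u, x} := mem_unhit.2 ⟨hj, by simpa using hcon⟩
        refine hp ⟨z, j, hju, hzj, fun l hl hzl => ?_⟩
        have hl' := mem_unhit.1 hl
        obtain ⟨i, hi, hzi, hui⟩ : ∃ i ∈ X, z ∈ A i ∧ u ∈ A i := by
          rcases Finset.mem_union.1 hz with hz | hz
          exacts [⟨e, he, hz, hue⟩, ⟨f, hf, hz, huf⟩]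
        rcases hdeg z i hi j hj l hl'.1 hzi hzj hzl with rfl | rfl | rfl
        · exact absurd hui hcon.1
        · exact absurd hui (hl'.2 u (by simp))
        · rfl
      · have := hlin.five_le_card_union h3 he hf hef
        omega
    obtain ⟨T, hT, hc⟩ := key
    exact ⟨⟨T, hT, by omega⟩, fun _ _ _ _ _ _ => ⟨T, hT, hc⟩⟩

lemma bounded_of_linear (hiso : ∀ i ∈ E, ∃ j ∈ E, j ≠ i ∧ ∃ v, v ∈ A i ∧ v ∈ A j) (hXE : X ⊆ E)
    (h3 : ∀ i ∈ X, 3 ≤ (A i).card) (hdeg : MaxDegreeTwo A X) (hlin : Linear A X) :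
    Bounded A E X 0 ∧ (Pendant A X → Bounded A E X 1) := by
  induction X using Finset.strongInduction with
  | H X ih =>
  have ih' : ∀ S : Finset α, ∀ v ∈ S, ∀ i ∈ X, v ∈ A i → Bounded A E (unhit A X S) 0 ∧
      (Pendant A (unhit A X S) → Bounded A E (unhit A X S) 1) := fun S v hv i hi hvi => by
    have hs := unhit_subset A X S
    exact ih _ (unhit_ssubset hi hv hvi) (hs.trans hXE) (fun i hi => h3 i (hs hi))
      (fun v i hi j hj l hl => hdeg v i (hs hi) j (hs hj) l (hs hl))
      (fun i hi j hj => hlin i (hs hi) j (hs hj))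
  have hpend : Pendant A X → Bounded A E X 1 := by
    rintro ⟨w, e, he, hwe, hw⟩
    by_cases hf : ∃ f ∈ X, f ≠ e ∧ ∃ u, u ∈ A e ∧ u ∈ A f
    · obtain ⟨f, hf, hfe, u, hue, huf⟩ := hf
      by_cases hg : ∃ g ∈ X, g ≠ e ∧ g ≠ f ∧ ∃ x, (x ∈ A e ∨ x ∈ A f) ∧ x ∈ A g
      · obtain ⟨g, hg, hge, hgf, x, hx | hx, hxg⟩ := hg
        · exact (bounded_of_path h3 hdeg hlin he hf hg hfe.symm hge.symm hgf.symm hue huf hx hxg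
            (ih' _ u (by simp) e he hue)).2 w e he hwe hw (by simp)
        · exact (bounded_of_path h3 hdeg hlin hf he hg hfe hgf.symm hge.symm huf hue hx hxg
            (ih' _ u (by simp) e he hue)).2 w e he hwe hw (by simp)
      · push Not at hg
        have huw : u ≠ w := by
          rintro rfl
          exact hfe (hw f hf huf)
        refine Bounded.step_two (Z := A e ∪ A f) (R := {e, f}) he hue hwe huw ?_ ?_ ?_
          (ih' _ u (by simp) e he hue).1 ?_
        · intro z hz
          rcases Finset.mem_union.1 hz with hz | hz
          exacts [⟨e, he, hz⟩, ⟨f, hf, hz⟩]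
        · intro z hz j hj hzj
          by_cases hje : j = e
          · simp [hje, hue]
          by_cases hjf : j = f
          · simp [hjf, huf]
          exact absurd hzj (hg j hj hje hjf z (Finset.mem_union.1 hz))
        · simp only [Finset.mem_insert, Finset.mem_singleton]
          rintro i (rfl | rfl) <;> simp [*]
        · have := hlin.five_le_card_union h3 he hf hfe.symm
          rw [Finset.card_pair hfe.symm]
          omega
    · push Not at hf
      obtain ⟨j, hj, hje, x, hxe, hxj⟩ := hiso e (hXE he)
      have hjX : j ∉ X := fun h => hf j h hje x hxe hxj
      refine Bounded.step_one (Z := A e) (R := {e}) ⟨j, hj, hjX, hxj⟩ ⟨e, he, hxe⟩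
        (fun z hz => ⟨e, he, hz⟩) ?_ (by simp [he, hxe]) (ih' _ x (by simp) e he hxe).1 ?_
      · intro z hz i hi hzi
        by_cases hie : i = e
        · rwa [hie]
        · exact absurd hzi (hf i hi hie z hz)
      · have := h3 e he
        rw [Finset.card_singleton]
        omega
  refine ⟨?_, hpend⟩
  by_cases hp : Pendant A X
  · obtain ⟨T, hT, hc⟩ := hpend hp
    exact ⟨T, hT, by omega⟩
  rcases X.eq_empty_or_nonempty with rfl | ⟨e, he⟩
  · exact bounded_empty
  have hother : ∀ v ∈ A e, ∃ f ∈ X, v ∈ A f ∧ e ≠ f := by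
    intro v hv
    by_contra! h
    exact hp ⟨v, e, he, hv, fun j hj hvj => (h j hj hvj).symm⟩
  obtain ⟨u, hu, x, hx, hux⟩ := Finset.one_lt_card.1 (lt_of_lt_of_le (by norm_num) (h3 e he))
  obtain ⟨f, hf, huf, hef⟩ := hother u hu
  obtain ⟨g, hg, hxg, heg⟩ := hother x hx
  have hfg : f ≠ g := by
    rintro rfl
    rcases hlin e he f hf u x hu huf hx hxg with h | h <;> contradiction
  exact (bounded_of_path h3 hdeg hlin he hf hg hef heg hfg hu huf hx hxg
    (ih' _ u (by simp) e he hu)).1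

end TotalTransversal

/-! ### Leaves, large degrees and double intersections -/

namespace TotalTransversal

variable {ι α : Type*} [DecidableEq ι] [DecidableEq α] {A : ι → Finset α} {E X : Finset ι}

/-- The edge `f` has at least two vertices and meets exactly one other edge, which has at least two
vertices outside `f`. -/
def IsLeaf (A : ι → Finset α) (E : Finset ι) (f : ι) : Prop :=
  2 ≤ (A f).card ∧ ∃ c ∈ E, c ≠ f ∧ 2 ≤ (A c \ A f).card ∧ (∃ x, x ∈ A f ∧ x ∈ A c) ∧
    ∀ j ∈ E, ∀ v, v ∈ A f → v ∈ A j → j = f ∨ j = c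

/-- Every edge through a vertex of `A f` is `f` or `c`, so choosing `x` in both kills all of `A f`.
If `c` is already hit, `x` alone pays 2 + 1. Otherwise add `y ∈ A c \ A f`: a third edge at `y` pays
3 + 3, and if there is none for any such `y`, all of `A c \ A f` dies and pays 4 + 2. -/
lemma bounded_of_isLeaf (hXE : X ⊆ E) {f : ι} (hf : f ∈ X) (hleaf : IsLeaf A E f)
    (ih : ∀ S : Finset α, ∀ v ∈ S, ∀ i ∈ X, v ∈ A i → Bounded A E (unhit A X S) 0) :
    Bounded A E X 0 := by
  obtain ⟨h2, c, hc, hcf, hcd, ⟨x, hxf, hxc⟩, hmeet⟩ := hleaf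
  have hdead : ∀ z ∈ A f, ∀ i ∈ X, z ∈ A i → x ∈ A i := by
    intro z hz i hi hzi
    rcases hmeet i (hXE hi) z hz hzi with rfl | rfl <;> assumption
  by_cases hcX : c ∈ X
  · have hxd : ∀ y ∈ A c \ A f, x ≠ y := by
      rintro y hy rfl
      exact (Finset.mem_sdiff.1 hy).2 hxf
    by_cases hj : ∃ y ∈ A c \ A f, ∃ j ∈ X, j ≠ c ∧ y ∈ A j
    · obtain ⟨y, hy, j, hj, hjc, hyj⟩ := hj
      have hy' := Finset.mem_sdiff.1 hy
      have hjf : j ≠ f := by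
        rintro rfl
        exact hy'.2 hyj
      refine Bounded.step_two (Z := insert y (A f)) (R := {f, c, j}) hcX hxc hy'.1 (hxd y hy)
        ?_ ?_ ?_ (ih _ x (by simp) f hf hxf) ?_
      · intro z hz
        rcases Finset.mem_insert.1 hz with rfl | hz
        exacts [⟨c, hcX, hy'.1⟩, ⟨f, hf, hz⟩]
      · intro z hz i hi hzi
        rcases Finset.mem_insert.1 hz with rfl | hz
        exacts [Or.inr hzi, Or.inl (hdead z hz i hi hzi)]
      · simp only [Finset.mem_insert, Finset.mem_singleton]
        rintro i (rfl | rfl | rfl) <;> simp [*]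
      · rw [Finset.card_insert_of_notMem hy'.2,
          Finset.card_eq_three.2 ⟨f, c, j, hcf.symm, hjf.symm, hjc.symm, rfl⟩]
        omega
    · push Not at hj
      obtain ⟨y, hy⟩ : (A c \ A f).Nonempty := Finset.card_pos.1 (by omega)
      have hy' := Finset.mem_sdiff.1 hy
      refine Bounded.step_two (Z := A f ∪ (A c \ A f)) (R := {f, c}) hcX hxc hy'.1 (hxd y hy)
        ?_ ?_ ?_ (ih _ x (by simp) f hf hxf) ?_
      · intro z hz
        rcases Finset.mem_union.1 hz with hz | hz
        exacts [⟨f, hf, hz⟩, ⟨c, hcX, (Finset.mem_sdiff.1 hz).1⟩]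
      · intro z hz i hi hzi
        left
        rcases Finset.mem_union.1 hz with hz | hz
        · exact hdead z hz i hi hzi
        · by_cases hic : i = c
          · rwa [hic]
          · exact absurd hzi (hj z hz i hi hic)
      · simp only [Finset.mem_insert, Finset.mem_singleton]
        rintro i (rfl | rfl) <;> simp [*]
      · rw [Finset.card_union_of_disjoint Finset.disjoint_sdiff, Finset.card_pair hcf.symm]
        omega
  · refine Bounded.step_one (Z := A f) (R := {f}) ⟨c, hc, hcX, hxc⟩ ⟨f, hf, hxf⟩
      (fun z hz => ⟨f, hf, hz⟩) hdead (by simp [hf, hxf]) (ih _ x (by simp) f hf hxf) ?_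
    rw [Finset.card_singleton]
    omega

/-- Take `v` on three edges. A neighbour `u` in `e` or `f` on an edge avoiding `v` makes four edges
hit and two vertices dead; without one, `v` alone kills `A e ∪ A f`. -/
lemma bounded_of_not_maxDegreeTwo (h3 : ∀ i ∈ X, 3 ≤ (A i).card)
    (hinj : ∀ i ∈ X, ∀ j ∈ X, i ≠ j → 4 ≤ (A i ∪ A j).card) (hdeg : ¬ MaxDegreeTwo A X)
    (ih : ∀ S : Finset α, ∀ v ∈ S, ∀ i ∈ X, v ∈ A i → Bounded A E (unhit A X S) 0) :
    Bounded A E X 0 := by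
  have hpair : ∀ i ∈ X, ∀ u v, u ∈ A i → v ∈ A i → u ≠ v →
      4 ≤ (X.filter fun j => u ∈ A j ∨ v ∈ A j).card → Bounded A E X 0 := by
    intro i hi u v hu hv huv h4
    refine Bounded.step_two (Z := {u, v}) (R := X.filter fun j => u ∈ A j ∨ v ∈ A j) hi hu hv huv
      ?_ ?_ (fun j hj => Finset.mem_filter.1 hj) (ih _ u (by simp) i hi hu) ?_
    · simp only [Finset.mem_insert, Finset.mem_singleton]
      rintro z (rfl | rfl) <;> exact ⟨i, hi, ‹_›⟩
    · simp only [Finset.mem_insert, Finset.mem_singleton]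
      rintro z (rfl | rfl) j hj hz <;> simp [hz]
    · rw [Finset.card_pair huv]
      omega
  unfold MaxDegreeTwo at hdeg
  push Not at hdeg
  obtain ⟨v, e, he, f, hf, g, hg, hve, hvf, hvg, hef, heg, hfg⟩ := hdeg
  have hDc : ({e, f, g} : Finset ι).card = 3 := Finset.card_eq_three.2 ⟨e, f, g, hef, heg, hfg, rfl⟩
  by_cases hout : ∃ i, (i = e ∨ i = f) ∧ ∃ u ∈ A i, u ≠ v ∧ ∃ j ∈ X, u ∈ A j ∧ v ∉ A j
  · obtain ⟨i, hi, u, hui, huv, j, hj, huj, hvj⟩ := hout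
    have hiX : i ∈ X ∧ v ∈ A i := by rcases hi with rfl | rfl <;> exact ⟨‹_›, ‹_›⟩
    refine hpair i hiX.1 u v hui hiX.2 huv ?_
    have hjD : j ∉ ({e, f, g} : Finset ι) := by
      simp only [Finset.mem_insert, Finset.mem_singleton]
      rintro (rfl | rfl | rfl) <;> contradiction
    rw [show 4 = (insert j ({e, f, g} : Finset ι)).card by
      rw [Finset.card_insert_of_notMem hjD, hDc]]
    refine Finset.card_le_card fun l hl => ?_
    simp only [Finset.mem_insert, Finset.mem_singleton] at hl
    rcases hl with rfl | rfl | rfl | rfl <;> simp [*]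
  · push Not at hout
    obtain ⟨u, hu, huv⟩ := Finset.exists_mem_ne (lt_of_lt_of_le (by norm_num) (h3 e he)) v
    refine Bounded.step_two (Z := A e ∪ A f) (R := {e, f, g}) he hu hve huv ?_ ?_ ?_
      (ih _ u (by simp) e he hu) ?_
    · intro z hz
      rcases Finset.mem_union.1 hz with hz | hz
      exacts [⟨e, he, hz⟩, ⟨f, hf, hz⟩]
    · intro z hz j hj hzj
      right
      by_cases hzv : z = v
      · rwa [← hzv]
      · rcases Finset.mem_union.1 hz with hz | hz
        exacts [hout e (Or.inl rfl) z hz hzv j hj hzj, hout f (Or.inr rfl) z hz hzv j hj hzj]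
    · simp only [Finset.mem_insert, Finset.mem_singleton]
      rintro i (rfl | rfl | rfl) <;> simp [*]
    · have := hinj e he f hf hef
      omega

/-- By the degree bound, vertices common to `e` and `f` lie on no third edge, so choosing `u` also
kills `v`. A third edge meeting `e` or `f` at `x` gives 3 + 3 with `{u, x}`; otherwise `e` and `f`
form a component, giving 4 + 2. -/
lemma bounded_of_not_linear (hinj : ∀ i ∈ X, ∀ j ∈ X, i ≠ j → 4 ≤ (A i ∪ A j).card)
    (hdeg : MaxDegreeTwo A X) (hlin : ¬ Linear A X)
    (ih : ∀ S : Finset α, ∀ v ∈ S, ∀ i ∈ X, v ∈ A i → Bounded A E (unhit A X S) 0) :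
    Bounded A E X 0 := by
  unfold Linear at hlin
  push Not at hlin
  obtain ⟨e, he, f, hf, u, v, hue, huf, hve, hvf, huv, hef⟩ := hlin
  have hdead : ∀ z, z ∈ A e → z ∈ A f → ∀ j ∈ X, z ∈ A j → j = e ∨ j = f := by
    intro z hze hzf j hj hzj
    rcases hdeg z e he f hf j hj hze hzf hzj with h | h | h
    exacts [absurd h hef, Or.inl h.symm, Or.inr h.symm]
  by_cases hg : ∃ g ∈ X, g ≠ e ∧ g ≠ f ∧ ∃ x, (x ∈ A e ∨ x ∈ A f) ∧ x ∈ A g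
  · obtain ⟨g, hg, hge, hgf, x, hx, hxg⟩ := hg
    have hne : ∀ z, z ∈ A e → z ∈ A f → z ≠ x := by
      rintro z hze hzf rfl
      rcases hdead z hze hzf g hg hxg with h | h <;> contradiction
    have hui : ∃ i ∈ X, u ∈ A i ∧ x ∈ A i := by
      rcases hx with hx | hx
      exacts [⟨e, he, hue, hx⟩, ⟨f, hf, huf, hx⟩]
    obtain ⟨i, hi, hui, hxi⟩ := hui
    refine Bounded.step_two (Z := {u, v, x}) (R := {e, f, g}) hi hui hxi (hne u hue huf) ?_ ?_ ?_
      (ih _ u (by simp) e he hue) ?_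
    · simp only [Finset.mem_insert, Finset.mem_singleton]
      rintro z (rfl | rfl | rfl)
      exacts [⟨e, he, hue⟩, ⟨e, he, hve⟩, ⟨g, hg, hxg⟩]
    · simp only [Finset.mem_insert, Finset.mem_singleton]
      rintro z (rfl | rfl | rfl) j hj hz
      · exact Or.inl hz
      · rcases hdead z hve hvf j hj hz with rfl | rfl
        exacts [Or.inl hue, Or.inl huf]
      · exact Or.inr hz
    · simp only [Finset.mem_insert, Finset.mem_singleton]
      rintro i (rfl | rfl | rfl) <;> simp [*]
    · rw [Finset.card_eq_three.2 ⟨e, f, g, hef, hge.symm, hgf.symm, rfl⟩,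
        Finset.card_eq_three.2 ⟨u, v, x, huv, hne u hue huf, hne v hve hvf, rfl⟩]
  · push Not at hg
    refine Bounded.step_two (Z := A e ∪ A f) (R := {e, f}) he hue hve huv ?_ ?_ ?_
      (ih _ u (by simp) e he hue) ?_
    · intro z hz
      rcases Finset.mem_union.1 hz with hz | hz
      exacts [⟨e, he, hz⟩, ⟨f, hf, hz⟩]
    · intro z hz j hj hzj
      by_cases hje : j = e
      · simp [hje, hue]
      by_cases hjf : j = f
      · simp [hjf, huf]
      exact absurd hzj (hg j hj hje hjf z (Finset.mem_union.1 hz))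
    · simp only [Finset.mem_insert, Finset.mem_singleton]
      rintro i (rfl | rfl) <;> simp [*]
    · have := hinj e he f hf hef
      rw [Finset.card_pair hef]
      omega

/-- Leaves are treated first; the remaining edges are then distinct sets of size at least 3, so any
two have a union of size at least 4. -/
theorem bounded (hiso : ∀ i ∈ E, ∃ j ∈ E, j ≠ i ∧ ∃ v, v ∈ A i ∧ v ∈ A j)
    (hE : ∀ i ∈ E, IsLeaf A E i ∨ 3 ≤ (A i).card ∧ ∀ j ∈ E, j ≠ i → A j ≠ A i) (hXE : X ⊆ E) :
    Bounded A E X 0 := by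
  induction X using Finset.strongInduction with
  | H X ih =>
  have ih' : ∀ S : Finset α, ∀ v ∈ S, ∀ i ∈ X, v ∈ A i → Bounded A E (unhit A X S) 0 :=
    fun S v hv i hi hvi =>
      ih _ (unhit_ssubset hi hv hvi) ((unhit_subset A X S).trans hXE)
  by_cases hleaf : ∃ f ∈ X, IsLeaf A E f
  · obtain ⟨f, hf, hleaf⟩ := hleaf
    exact bounded_of_isLeaf hXE hf hleaf ih'
  push Not at hleaf
  have h3 : ∀ i ∈ X, 3 ≤ (A i).card := fun i hi =>
    ((hE i (hXE hi)).resolve_left (hleaf i hi)).1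
  have hinj : ∀ i ∈ X, ∀ j ∈ X, i ≠ j → 4 ≤ (A i ∪ A j).card := by
    intro i hi j hj hij
    by_contra! h
    have h1 := Finset.eq_of_subset_of_card_le (Finset.subset_union_left (s₁ := A i) (s₂ := A j))
      (by have := h3 i hi; omega)
    have h2 := Finset.eq_of_subset_of_card_le (Finset.subset_union_right (s₁ := A i) (s₂ := A j))
      (by have := h3 j hj; omega)
    exact ((hE j (hXE hj)).resolve_left (hleaf j hj)).2 i (hXE hi) hij (h1.trans h2.symm)
  by_cases hdeg : MaxDegreeTwo A X
  · by_cases hlin : Linear A X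
    · exact (bounded_of_linear hiso hXE h3 hdeg hlin).1
    · exact bounded_of_not_linear hinj hdeg hlin ih'
  · exact bounded_of_not_maxDegreeTwo h3 hinj hdeg ih'

end TotalTransversal

/-! ### Minimal spanning families and tokens -/

namespace TotalTransversal

variable {α : Type*} [DecidableEq α]

/-- `C` covers `V` and has no isolated edge. -/
def IsSpanning (V : Finset α) (C : Finset (Finset α)) : Prop :=
  (∀ v ∈ V, ∃ e ∈ C, v ∈ e) ∧ ∀ e ∈ C, ∃ f ∈ C, f ≠ e ∧ ∃ v, v ∈ e ∧ v ∈ f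

/-- `v` lies in `e` and in no other edge of `C`. -/
def IsPrivate (C : Finset (Finset α)) (e : Finset α) (v : α) : Prop :=
  v ∈ e ∧ ∀ f ∈ C, v ∈ f → f = e

/-- `l` meets `e` and no further edge of `C`. -/
def IsLeafAt (C : Finset (Finset α)) (l e : Finset α) : Prop :=
  l ≠ e ∧ (∃ x, x ∈ l ∧ x ∈ e) ∧ ∀ g ∈ C, ∀ v, v ∈ l → v ∈ g → g = l ∨ g = e

lemma exists_minimal_spanning {V : Finset α} {C₀ : Finset (Finset α)} (h : IsSpanning V C₀) :
    ∃ C ⊆ C₀, IsSpanning V C ∧ ∀ e ∈ C, ¬ IsSpanning V (C.erase e) := by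
  classical
  obtain ⟨C, hC, hmin⟩ := Finset.exists_min_image (C₀.powerset.filter (IsSpanning V)) Finset.card
    ⟨C₀, by simpa using h⟩
  simp only [Finset.mem_filter, Finset.mem_powerset] at hC hmin
  refine ⟨C, hC.1, hC.2, fun e he hs => ?_⟩
  have := hmin _ ⟨(Finset.erase_subset e C).trans hC.1, hs⟩
  have := Finset.card_erase_lt_of_mem he
  omega

/-- Removing `e` either uncovers a vertex, which was private to `e`, or isolates an edge `l` whose
only neighbour was `e`. -/
lemma exists_isPrivate_or_isLeafAt {V : Finset α} {C : Finset (Finset α)} (hC : IsSpanning V C)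
    (hmin : ∀ e ∈ C, ¬ IsSpanning V (C.erase e)) {e : Finset α} (he : e ∈ C) :
    (∃ v, IsPrivate C e v) ∨ ∃ l ∈ C, IsLeafAt C l e := by
  have h := hmin e he
  unfold IsSpanning at h
  rw [not_and_or] at h
  rcases h with h | h
  · left
    push Not at h
    obtain ⟨v, hv, hve⟩ := h
    have honly : ∀ f ∈ C, v ∈ f → f = e := fun f hf hvf => by
      by_contra hne
      exact hve f (Finset.mem_erase.2 ⟨hne, hf⟩) hvf
    obtain ⟨f, hf, hvf⟩ := hC.1 v hv
    exact ⟨v, honly f hf hvf ▸ hvf, honly⟩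
  · right
    push Not at h
    obtain ⟨l, hl, hle⟩ := h
    rw [Finset.mem_erase] at hl
    have honly : ∀ g ∈ C, ∀ v, v ∈ l → v ∈ g → g = l ∨ g = e := by
      intro g hg v hvl hvg
      by_contra! hne
      exact hle g (Finset.mem_erase.2 ⟨hne.2, hg⟩) hne.1 v hvl hvg
    obtain ⟨f, hf, hfl, v, hvl, hvf⟩ := hC.2 l hl.2
    have hfe := (honly f hf v hvl hvf).resolve_left hfl
    exact ⟨l, hl.2, hl.1, ⟨v, hvl, hfe ▸ hvf⟩, honly⟩

lemma card_inter_add_two_le {k : ℕ} {C : Finset (Finset α)} (hunif : ∀ e ∈ C, e.card = k)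
    (hinter : ∀ e ∈ C, ∀ f ∈ C, e ≠ f → (e ∩ f).card + 1 ≠ k) {e f : Finset α} (he : e ∈ C)
    (hf : f ∈ C) (hef : e ≠ f) : (e ∩ f).card + 2 ≤ k := by
  have h1 : (e ∩ f).card ≤ e.card := Finset.card_le_card Finset.inter_subset_left
  have h2 : (e ∩ f).card ≠ k := by
    intro h
    have h3 := Finset.eq_of_subset_of_card_le (Finset.inter_subset_left (s₁ := e) (s₂ := f))
      (by rw [h, hunif e he])
    have h4 := Finset.eq_of_subset_of_card_le (Finset.inter_subset_right (s₁ := e) (s₂ := f))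
      (by rw [h, hunif f hf])
    exact hef (h3.symm.trans h4)
  have := hinter e he f hf hef
  have := hunif e he
  omega

/-- In a minimal spanning family, every edge `e` can be given a vertex `t e` of its own that is
private to some edge `l e`, where `l e` is `e` itself, or a leaf at `e` if `e` has no private
vertex. -/
lemma exists_tokens {k : ℕ} {V : Finset α} {C : Finset (Finset α)} [Nonempty α]
    (hunif : ∀ e ∈ C, e.card = k)
    (hinter : ∀ e ∈ C, ∀ f ∈ C, e ≠ f → (e ∩ f).card + 1 ≠ k) (hC : IsSpanning V C)
    (hmin : ∀ e ∈ C, ¬ IsSpanning V (C.erase e)) :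
    ∃ (t : Finset α → α) (l : Finset α → Finset α), Set.InjOn t C ∧
      ∀ e ∈ C, l e ∈ C ∧ IsPrivate C (l e) (t e) ∧
        (l e = e ∨ (¬ ∃ v, IsPrivate C e v) ∧ IsLeafAt C (l e) e) := by
  classical
  have hp : ∀ e, ∃ v, (∃ v, IsPrivate C e v) → IsPrivate C e v := fun e => by
    by_cases h : ∃ v, IsPrivate C e v
    · exact ⟨h.choose, fun _ => h.choose_spec⟩
    · exact ⟨Classical.arbitrary α, fun h' => absurd h' h⟩
  choose p hp using hp
  have key : ∀ e ∈ C, ∃ t l, l ∈ C ∧ IsPrivate C l t ∧ ((l = e ∧ t = p e) ∨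
      (¬ ∃ v, IsPrivate C e v) ∧ IsLeafAt C l e ∧ t ≠ p l) := by
    intro e he
    by_cases h : ∃ v, IsPrivate C e v
    · exact ⟨p e, e, he, hp e h, Or.inl ⟨rfl, rfl⟩⟩
    · obtain ⟨l, hl, hle⟩ := (exists_isPrivate_or_isLeafAt hC hmin he).resolve_left h
      have h2 := card_inter_add_two_le hunif hinter hl he hle.1
      have h3 := Finset.card_sdiff_add_card_inter l e
      have := hunif l hl
      -- Every vertex of `l \ e` is private to `l`, and there are at least two, so one differs from
      -- the token `p l` that `l` keeps for itself.
      obtain ⟨t, ht, htp⟩ := Finset.exists_mem_ne (s := l \ e) (by omega) (p l)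
      rw [Finset.mem_sdiff] at ht
      refine ⟨t, l, hl, ⟨ht.1, fun f hf htf => ?_⟩, Or.inr ⟨h, hle, htp⟩⟩
      rcases hle.2.2 f hf t ht.1 htf with rfl | rfl
      exacts [rfl, absurd htf ht.2]
  choose! t l hl ht hcase using key
  refine ⟨t, l, fun e he f hf hef => ?_, fun e he => ⟨hl e he, ht e he, ?_⟩⟩
  · have hll : l e = l f := (ht f hf).2 _ (hl e he) (hef ▸ (ht e he).1)
    rcases hcase e he with ⟨h1, h2⟩ | ⟨-, h1, h2⟩ <;> rcases hcase f hf with ⟨h3, h4⟩ | ⟨-, h3, h4⟩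
    · exact h1.symm.trans (hll.trans h3)
    · exact absurd (by rw [← hll, ← hef, h1, h2]) h4
    · exact absurd (by rw [hll, hef, h3, h4]) h2
    -- A leaf has a single neighbour, so it serves at most one edge.
    · obtain ⟨x, hx, hxf⟩ := h3.2.1
      rcases h1.2.2 f hf x (hll ▸ hx) hxf with h | h
      · exact absurd (h.trans hll).symm h3.1
      · exact h.symm
  · rcases hcase e he with ⟨h, -⟩ | ⟨h1, h2, -⟩
    exacts [Or.inl h, Or.inr ⟨h1, h2⟩]

lemma exists_total_of_minimal {k : ℕ} (hk : 4 ≤ k) {V : Finset α} {C : Finset (Finset α)}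
    (hV : ∀ e ∈ C, e ⊆ V) (hunif : ∀ e ∈ C, e.card = k)
    (hinter : ∀ e ∈ C, ∀ f ∈ C, e ≠ f → (e ∩ f).card + 1 ≠ k) (hC : IsSpanning V C)
    (hmin : ∀ e ∈ C, ¬ IsSpanning V (C.erase e)) :
    ∃ T ⊆ V, 3 * T.card ≤ V.card ∧ ∀ v ∈ V, ∃ e ∈ C, v ∈ e ∧ ∃ w ∈ T, w ≠ v ∧ w ∈ e := by
  rcases V.eq_empty_or_nonempty with rfl | ⟨v₀, -⟩
  · exact ⟨∅, by simp⟩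
  have : Nonempty α := ⟨v₀⟩
  obtain ⟨t, l, htinj, ht⟩ := exists_tokens hunif hinter hC hmin
  obtain ⟨A, hA⟩ : ∃ A : Finset α → Finset α, ∀ e, A e = e \ C.image t := ⟨_, fun _ => rfl⟩
  have hmemA : ∀ e v, v ∈ A e ↔ v ∈ e ∧ ∀ j ∈ C, t j ≠ v := by
    intro e v
    simp [hA]
  have hAsub : ∀ e, A e ⊆ e := fun e v hv => ((hmemA e v).1 hv).1
  have hshared : ∀ e ∈ C, ∀ f ∈ C, e ≠ f → ∀ v, v ∈ e → v ∈ f → v ∈ A e := by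
    intro e he f hf hef v hve hvf
    refine (hmemA e v).2 ⟨hve, ?_⟩
    rintro j hj rfl
    have h := (ht j hj).2.1.2
    exact hef ((h e he hve).trans (h f hf hvf).symm)
  have hiso : ∀ e ∈ C, ∃ f ∈ C, f ≠ e ∧ ∃ v, v ∈ A e ∧ v ∈ A f := by
    intro e he
    obtain ⟨f, hf, hfe, v, hve, hvf⟩ := hC.2 e he
    exact ⟨f, hf, hfe, v, hshared e he f hf hfe.symm v hve hvf, hshared f hf e he hfe v hvf hve⟩
  have htoken : ∀ e ∈ C, ∀ j ∈ C, t j ∈ e → l j = e := by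
    intro e he j hj hje
    exact ((ht j hj).2.1.2 e he hje).symm
  have hE : ∀ e ∈ C, IsLeaf A C e ∨ 3 ≤ (A e).card ∧ ∀ f ∈ C, f ≠ e → A f ≠ A e := by
    intro e he
    have hek := hunif e he
    by_cases hleaf : ∃ j ∈ C, l j = e ∧ (¬ ∃ v, IsPrivate C j v) ∧ IsLeafAt C e j
    · left
      obtain ⟨j, hj, -, hjp, hej⟩ := hleaf
      have hAj : A j = j := by
        refine (hAsub j).antisymm fun v hv => (hmemA j v).2 ⟨hv, ?_⟩
        rintro i hi rfl
        have h1 := htoken j hj i hi hv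
        exact hjp ⟨t i, h1 ▸ (ht i hi).2.1⟩
      refine ⟨?_, j, hj, hej.1.symm, ?_, ?_, ?_⟩
      -- A leaf loses at most its own token and that of its neighbour `j`, leaving `k - 2 ≥ 2`
      -- vertices.
      · have hsub : (e.erase (t e)).erase (t j) ⊆ A e := by
          intro v hv
          rw [Finset.mem_erase, Finset.mem_erase] at hv
          refine (hmemA e v).2 ⟨hv.2.2, ?_⟩
          rintro i hi rfl
          have hli := htoken e he i hi hv.2.2
          rcases (ht i hi).2.2 with h | ⟨-, h⟩
          · rw [← h, hli] at hv
            exact hv.2.1 rfl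
          · rw [hli] at h
            obtain ⟨x, hxe, hxi⟩ := h.2.1
            rcases hej.2.2 i hi x hxe hxi with h' | rfl
            · exact h.1 h'.symm
            · exact hv.1 rfl
        have h1 := Finset.card_le_card hsub
        have h2 := Finset.pred_card_le_card_erase (s := e) (a := t e)
        have h3 := Finset.pred_card_le_card_erase (s := e.erase (t e)) (a := t j)
        omega
      · have h1 := card_inter_add_two_le hunif hinter hj he hej.1.symm
        have h2 := Finset.card_sdiff_add_card_inter j e
        have h3 := hunif j hj
        have h4 : (j \ e).card ≤ (A j \ A e).card := by
          rw [hAj]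
          exact Finset.card_le_card (Finset.sdiff_subset_sdiff le_rfl (hAsub e))
        omega
      · obtain ⟨x, hxe, hxj⟩ := hej.2.1
        exact ⟨x, hshared e he j hj hej.1 x hxe hxj, hAj.symm ▸ hxj⟩
      · exact fun g hg v hve hvg => hej.2.2 g hg v (hAsub e hve) (hAsub g hvg)
    · right
      -- Only its own token can be lost, leaving `k - 1 ≥ 3` vertices. Two equal reduced edges would
      -- then force an intersection of size at least `k - 1`.
      have hsub : e.erase (t e) ⊆ A e := by
        intro v hv
        rw [Finset.mem_erase] at hv
        refine (hmemA e v).2 ⟨hv.2, ?_⟩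
        rintro i hi rfl
        have hli := htoken e he i hi hv.2
        rcases (ht i hi).2.2 with h | ⟨h1, h2⟩
        · rw [← h, hli] at hv
          exact hv.1 rfl
        · exact hleaf ⟨i, hi, hli, h1, hli ▸ h2⟩
      have h1 := Finset.card_le_card hsub
      have h2 := Finset.pred_card_le_card_erase (s := e) (a := t e)
      refine ⟨by omega, fun f hf hfe hA' => ?_⟩
      have h3 := card_inter_add_two_le hunif hinter he hf hfe.symm
      have h4 : (A e).card ≤ (e ∩ f).card :=
        Finset.card_le_card (Finset.subset_inter (hAsub e) (hA' ▸ hAsub f))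
      omega
  obtain ⟨T, hT, hTc⟩ := bounded hiso hE subset_rfl
  have hTV : T ⊆ V := fun v hv => by
    obtain ⟨e, he, hve⟩ := Finset.mem_biUnion.1 (hT.subset hv)
    exact hV e he (hAsub e hve)
  refine ⟨T, hTV, ?_, fun v hv => ?_⟩
  · have h1 : (C.biUnion A).card + (C.image t).card ≤ V.card := by
      rw [← Finset.card_union_of_disjoint]
      · refine Finset.card_le_card (Finset.union_subset (fun v hv => ?_) fun v hv => ?_)
        · obtain ⟨e, he, hve⟩ := Finset.mem_biUnion.1 hv
          exact hV e he (hAsub e hve)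
        · obtain ⟨e, he, rfl⟩ := Finset.mem_image.1 hv
          exact hV _ (ht e he).1 (ht e he).2.1.1
      · refine Finset.disjoint_left.2 fun v hv hvt => ?_
        obtain ⟨e, he, hve⟩ := Finset.mem_biUnion.1 hv
        rw [hA, Finset.mem_sdiff] at hve
        exact hve.2 hvt
    rw [Finset.card_image_of_injOn htinj] at h1
    unfold weight at hTc
    omega
  · obtain ⟨e, he, hve⟩ := hC.1 v hv
    obtain ⟨w, hw, hwe⟩ := hT.hits e he
    -- If `v` itself is the hitting vertex, its support provides another; with `X = E = C` no edge
    -- lies outside `X`.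
    by_cases hwv : w = v
    · subst hwv
      rcases hT.supported w hw with ⟨i, hi, u, hu, huw, hwi, hui⟩ | ⟨i, hi, hiC, -⟩
      · exact ⟨i, hi, hAsub i hwi, u, hu, huw, hAsub i hui⟩
      · exact absurd hi hiC
    · exact ⟨e, he, hve, w, hw, hwv, hAsub e hwe⟩

end TotalTransversal

/-! ### Transfer to hypergraphs -/

namespace Hypergraph

theorem MemClassHStar.exists_isTotalDominatingSet {α : Type*} {H : Hypergraph α} {k : ℕ}
    (hk : 4 ≤ k) (hH : H.MemClassHStar k) :
    ∃ T : Finset α, H.IsTotalDominatingSet T ∧ 3 * T.card ≤ H.vertexSet.ncard := by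
  classical
  obtain ⟨V, hV⟩ := hH.finite.exists_finset_coe
  obtain ⟨C, hC⟩ : ∃ C : Finset (Finset α), ∀ e, e ∈ C ↔ (e : Set α) ∈ H.edgeSet := by
    refine ⟨V.powerset.filter fun e => (e : Set α) ∈ H.edgeSet, fun e => ?_⟩
    simp only [Finset.mem_filter, Finset.mem_powerset, and_iff_right_iff_imp]
    intro he
    have := H.subset_vertexSet_of_mem_edgeSet' he
    rw [← hV] at this
    exact_mod_cast this
  have hlift : ∀ s ∈ H.edgeSet, ∃ e ∈ C, (e : Set α) = s := by
    intro s hs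
    obtain ⟨e, rfl⟩ := (hH.finite.subset (H.subset_vertexSet_of_mem_edgeSet' hs)).exists_finset_coe
    exact ⟨e, (hC e).2 hs, rfl⟩
  have hCV : ∀ e ∈ C, e ⊆ V := by
    intro e he
    have := H.subset_vertexSet_of_mem_edgeSet' ((hC e).1 he)
    rw [← hV] at this
    exact_mod_cast this
  have hspan : TotalTransversal.IsSpanning V C := by
    refine ⟨fun v hv => ?_, fun e he => ?_⟩
    · have h := hH.no_isolated_vertex v (hV ▸ hv)
      simp only [IsIsolated, not_forall, not_not] at h
      obtain ⟨s, hs, hvs⟩ := h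
      obtain ⟨e, he, rfl⟩ := hlift s hs
      exact ⟨e, he, hvs⟩
    · have h := hH.no_isolated_edge e
      simp only [IsIsolatedEdge, not_and, not_forall] at h
      obtain ⟨s, hs, hse, hd⟩ := h ((hC e).1 he)
      obtain ⟨f, hf, rfl⟩ := hlift s hs
      obtain ⟨v, hve, hvf⟩ := Set.not_disjoint_iff.1 hd
      exact ⟨f, hf, fun h => hse (congrArg _ h), v, hve, hvf⟩
  have hunif : ∀ e ∈ C, e.card = k := by
    intro e he
    have := hH.uniform e ((hC e).1 he)
    rw [Set.encard_coe_eq_coe_finsetCard] at this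
    exact_mod_cast this
  have hinter : ∀ e ∈ C, ∀ f ∈ C, e ≠ f → (e ∩ f).card + 1 ≠ k := by
    intro e he f hf hef
    have := hH.inter_ne e ((hC e).1 he) f ((hC f).1 hf) (fun h => hef (Finset.coe_injective h))
    rw [← Finset.coe_inter, Set.encard_coe_eq_coe_finsetCard] at this
    exact_mod_cast this
  obtain ⟨C', hC', hspan', hmin⟩ := TotalTransversal.exists_minimal_spanning hspan
  obtain ⟨T, hTV, hTc, hT⟩ := TotalTransversal.exists_total_of_minimal hk
    (fun e he => hCV e (hC' he)) (fun e he => hunif e (hC' he))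
    (fun e he f hf => hinter e (hC' he) f (hC' hf)) hspan' hmin
  refine ⟨T, ⟨?_, fun v hv => ?_⟩, ?_⟩
  · rw [← hV]
    exact_mod_cast hTV
  · rw [← hV] at hv
    obtain ⟨e, he, hve, w, hw, hwv, hwe⟩ := hT v hv
    exact ⟨e, (hC e).1 (hC' he), hve, w, hwe, hw, hwv⟩
  · rwa [← hV, Set.ncard_coe_finset]

end Hypergraph

theorem corollary5 {α : Type*} (H : Hypergraph α) (k : ℕ) (hk : 4 ≤ k)
    (hH : H.MemClassHStar k) :
    (H.totalDominationNumber : ℝ) ≤ (H.vertexSet.ncard : ℝ) / 3 := by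
  obtain ⟨T, hT, hTc⟩ := hH.exists_isTotalDominatingSet hk
  have h1 : H.totalDominationNumber ≤ T.card :=
    Nat.sInf_le ⟨T, hT, Set.encard_coe_eq_coe_finsetCard T⟩
  rw [le_div_iff₀ (by norm_num)]
  exact_mod_cast (by omega : H.totalDominationNumber * 3 ≤ H.vertexSet.ncard)
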